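/- Let $H_m=\sum_{i=1}^m \frac1i$ (with $H_0=0$), and let $n\ge 1$ be an integer. For $0<t<1$ put $$f_0(t)=-\frac{t\log(1-t)}{1-t},\quad f_1(t)=\frac{t\log(1-t)-t^2}{(1-t)^2},\quad f_2(t)=\frac{4t\log(1-t)-t\log^2(1-t)}{2(1-t)^2},$$ $$f_3(t)=\frac{\log^2(1-t)}{2(1-t)^2},\quad f_4(t)=\frac{2t-t\log(1-t)}{(1-t)^2},\quad f_5(t)=\frac{\log(1-t)}{(1-t)^2},$$ $$c_{n,p}=\sum_{k=1}^{n-p}\left(\frac{H_{p+k}-H_k}{(p+k)k}+\frac1{k^2(p+k)}\right)\qquad(0\le p\le n-1),$$ and $$\begin{aligned} F_n(t)={}&f_0(t)+f_1(t)\sum_{k=1}^{n}\frac1k\left(\frac{t-1}{t}\right)^k-f_2(t)\sum_{k=1}^{n}\left(\frac{t-1}{t}\right)^k-f_3(t)\sum_{k=1}^{n}k\left(\frac{t-1}{t}\right)^k\\ &+f_4(t)\sum_{k=1}^{n}H_k\left(\frac{t-1}{t}\right)^k+f_5(t)\sum_{k=1}^{n}kH_k\left(\frac{t-1}{t}\right)^k-\frac{t}{(1-t)^2}\sum_{k=1}^{n}\frac{H_k}{k}\left(\frac{t-1}{t}\right)^k\\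 &+\frac{t}{(1-t)^2}\sum_{p=0}^{n-1}c_{n,p}\,p\left(\frac{t-1}{t}\right)^p-\frac{1}{(1-t)^2}\sum_{p=0}^{n-1}c_{n,p}\,p^2\left(\frac{t-1}{t}\right)^p . \end{aligned}$$ Then for every $0<t<1$ the series below converges and $$\sum_{k=1}^{\infty}\frac{H_{k-1}\,t^k}{\binom{n+k}{k}}=F_n(t).$$ If $n\ge 2$, the identity also holds at $t=1$, where the right-hand side, whose formula is singular there, is understood as its limit: the series $\sum_{k\ge1}H_{k-1}/\binom{n+k}{k}$ converges and $$\sum_{k=1}^{\infty}\frac{H_{k-1}}{\binom{n+k}{k}}=\lim_{t\to1^-}F_n(t).$$ -/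

import Mathlib

open scoped Topology

noncomputable section

namespace HarmBinom

/-- The harmonic number `H_m = ∑_{i=1}^m 1/i` as a real number, with `H_0 = 0`. -/
def H (m : ℕ) : ℝ := ((harmonic m : ℚ) : ℝ)

/-- The `k`-th term `H_{k-1} t^k / C(n+k,k)` of the series (used for `k ≥ 1`). -/
def term (n : ℕ) (t : ℝ) (k : ℕ) : ℝ :=
  H (k - 1) * t ^ k / ((n + k).choose k : ℝ)

def f₀ (t : ℝ) : ℝ := -(t * Real.log (1 - t)) / (1 - t)

def f₁ (t : ℝ) : ℝ := (t * Real.log (1 - t) - t ^ 2) / (1 - t) ^ 2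

def f₂ (t : ℝ) : ℝ :=
  (4 * t * Real.log (1 - t) - t * Real.log (1 - t) ^ 2) / (2 * (1 - t) ^ 2)

def f₃ (t : ℝ) : ℝ := Real.log (1 - t) ^ 2 / (2 * (1 - t) ^ 2)

def f₄ (t : ℝ) : ℝ := (2 * t - t * Real.log (1 - t)) / (1 - t) ^ 2

def f₅ (t : ℝ) : ℝ := Real.log (1 - t) / (1 - t) ^ 2

/-- The inner sum `∑_{k=1}^{n-p} ((H_{p+k} - H_k)/((p+k)k) + 1/(k²(p+k)))`, for `p < n`. -/
def c (n p : ℕ) : ℝ :=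
  ∑ k ∈ Finset.Icc 1 (n - p),
    ((H (p + k) - H k) / (((p : ℝ) + k) * k) + 1 / ((k : ℝ) ^ 2 * ((p : ℝ) + k)))

/-- The closed form, meaningful as an explicit expression for `0 < t < 1`. -/
def closedForm (n : ℕ) (t : ℝ) : ℝ :=
  f₀ t
    + f₁ t * ∑ k ∈ Finset.Icc 1 n, 1 / (k : ℝ) * ((t - 1) / t) ^ k
    - f₂ t * ∑ k ∈ Finset.Icc 1 n, ((t - 1) / t) ^ k
    - f₃ t * ∑ k ∈ Finset.Icc 1 n, (k : ℝ) * ((t - 1) / t) ^ k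
    + f₄ t * ∑ k ∈ Finset.Icc 1 n, H k * ((t - 1) / t) ^ k
    + f₅ t * ∑ k ∈ Finset.Icc 1 n, (k : ℝ) * H k * ((t - 1) / t) ^ k
    - t / (1 - t) ^ 2 * ∑ k ∈ Finset.Icc 1 n, H k / (k : ℝ) * ((t - 1) / t) ^ k
    + t / (1 - t) ^ 2 * ∑ p ∈ Finset.range n, c n p * (p : ℝ) * ((t - 1) / t) ^ p
    - 1 / (1 - t) ^ 2 * ∑ p ∈ Finset.range n, c n p * (p : ℝ) ^ 2 * ((t - 1) / t) ^ p

end HarmBinom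

end

/-!
Write `x = (t - 1) / t`, `L = log (1 - t)` and `β n j = n! j! / (n+j+1)!`. With `k = j + 1` one has
`1 / (n+k).choose k = n (β (n-1) j - β n j)`, so that the series is `n (V_{n-1} - V_n)` with
`V_n = ∑_j H_j t^(j+1) β n j`.

The relation `β n j - β n (j+1) = β (n+1) j` expresses the series for `n + 1` as the one for `n`
minus its shift. For `W_n = ∑_j t^(j+1) β n j` this gives `W_{n+1} = x W_n + 1/(n+1)` with
`W_0 = -L`, and for `V_n`, because `β n (j+1) / (j+1) = β (n+1) j / (n+1)`, it gives
`V_{n+1} = x V_n + W_{n+1}/(n+1)` with `V_0 = L²/2`. Solving these recurrences yields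
`V_n = x^n L²/2 - H_n x^n L + C_n(x)`, where `C_n` is the polynomial `cPoly`
(`hasSum_beta`, `hasSum_H_mul_beta`).

It remains to see that the closed form is `n (V_{n-1} - V_n)` (`closedForm_eq`). Both sides are
quadratic in `L`, and the three coefficients are compared by induction on `n`. For `L²` and `L` this
is summation by parts. For the coefficient free of `L`, the point is that
`c_{n,p} - c_{n-1,p}` is `1/n` times the coefficient of `x^p` in `C_n`; the weights `p` and `p²` are
expanded in powers of `n - p`, and `n - p` cancels the denominator of that coefficient
(`rational_part_closedForm`).

At `t = 1` with `n ≥ 2` the series converges absolutely, and Abel's limit theorem transfers the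
identity on `0 < t < 1` to the limit.
-/

noncomputable section

namespace HarmBinom

/-! ### Coefficient polynomials -/

/-- `∑_{p<n} x^p / (n-p)`, the polynomial solution of `a_{n+1} = x a_n + 1/(n+1)`, `a_0 = 0`. -/
def aPoly (x : ℝ) (n : ℕ) : ℝ := ∑ p ∈ Finset.range n, x ^ p / ((n : ℝ) - p)

/-- `∑_{p<n} (H_n - H_{n-1-p})/(n-p) x^p`, the polynomial solution of
`c_{n+1} = x c_n + a_{n+1}/(n+1)`, `c_0 = 0`, where `a_n = aPoly x n`. Its coefficients are
`n (c_{n,p} - c_{n-1,p})`. -/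
def cPoly (x : ℝ) (n : ℕ) : ℝ :=
  ∑ p ∈ Finset.range n, (H n - H (n - 1 - p)) / ((n : ℝ) - p) * x ^ p

/-- The coefficients of `cPoly`, each multiplied by `n - p`. -/
def zPoly (x : ℝ) (n : ℕ) : ℝ := ∑ p ∈ Finset.range n, (H n - H (n - 1 - p)) * x ^ p

/-- The coefficients of `cPoly`, each multiplied by `(n - p)^2`. -/
def rPoly (x : ℝ) (n : ℕ) : ℝ :=
  ∑ p ∈ Finset.range n, ((n : ℝ) - p) * (H n - H (n - 1 - p)) * x ^ p

/-- The sum of the series `∑_{k≥1} H_{k-1} t^k n!(k-1)!/(n+k)!`, in closed form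
(see `hasSum_H_mul_beta`). -/
def vSum (t : ℝ) (n : ℕ) : ℝ :=
  cPoly ((t - 1) / t) n - H n * ((t - 1) / t) ^ n * Real.log (1 - t)
    + ((t - 1) / t) ^ n * (Real.log (1 - t) ^ 2 / 2)

theorem H_zero : H 0 = 0 := by simp [H]

theorem H_succ (n : ℕ) : H (n + 1) = H n + 1 / ((n : ℝ) + 1) := by
  simp [H, harmonic_succ]

/-! ### Recurrences of the coefficient polynomials -/

theorem aPoly_succ (x : ℝ) (n : ℕ) : aPoly x (n + 1) = x * aPoly x n + 1 / ((n : ℝ) + 1) := by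
  unfold aPoly
  rw [Finset.sum_range_succ', Finset.mul_sum]
  congr 1
  · refine Finset.sum_congr rfl fun p _ => ?_
    push_cast
    rw [add_sub_add_right_eq_sub]
    ring
  · simp

theorem cPoly_succ (x : ℝ) (n : ℕ) :
    cPoly x (n + 1) = x * cPoly x n + aPoly x (n + 1) / ((n : ℝ) + 1) := by
  rw [aPoly_succ, add_div, ← add_assoc]
  unfold cPoly aPoly
  rw [Finset.sum_range_succ', mul_div_right_comm, mul_comm (x / _), Finset.mul_sum,
    Finset.sum_mul, ← Finset.sum_add_distrib]
  congr 1
  · refine Finset.sum_congr rfl fun p _ => ?_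
    rw [show n + 1 - 1 - (p + 1) = n - 1 - p by omega, H_succ]
    push_cast
    rw [add_sub_add_right_eq_sub]
    ring
  · simp [H_succ]

theorem zPoly_succ (x : ℝ) (n : ℕ) :
    zPoly x (n + 1) = x * zPoly x n + (∑ p ∈ Finset.range (n + 1), x ^ p) / ((n : ℝ) + 1) := by
  unfold zPoly
  rw [Finset.sum_range_succ', Finset.sum_range_succ', add_div, ← add_assoc, Finset.mul_sum,
    Finset.sum_div, ← Finset.sum_add_distrib]
  congr 1
  · refine Finset.sum_congr rfl fun p _ => ?_
    rw [show n + 1 - 1 - (p + 1) = n - 1 - p by omega, H_succ]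
    ring
  · simp [H_succ]

/-- Summation by parts: the differences of the coefficients of `zPoly` are those of `aPoly`. -/
theorem one_sub_mul_zPoly (x : ℝ) (n : ℕ) :
    (1 - x) * zPoly x n = aPoly x n - H n * x ^ n := by
  induction n with
  | zero => simp [zPoly, aPoly, H_zero]
  | succ n ih =>
    have hg := mul_neg_geom_sum x (n + 1)
    rw [zPoly_succ, aPoly_succ, H_succ]
    linear_combination x * ih + hg / ((n : ℝ) + 1)

theorem rPoly_succ (x : ℝ) (n : ℕ) :
    rPoly x (n + 1) = x * rPoly x n + ∑ p ∈ Finset.range (n + 1), ((n : ℝ) + 1 - p) * x ^ p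
       / ((n : ℝ) + 1) := by
  unfold rPoly
  rw [Finset.sum_range_succ', Finset.sum_range_succ', ← add_assoc, Finset.mul_sum,
    ← Finset.sum_add_distrib]
  congr 1
  · refine Finset.sum_congr rfl fun p _ => ?_
    rw [show n + 1 - 1 - (p + 1) = n - 1 - p by omega, H_succ]
    push_cast
    ring
  · simp [H_succ, div_eq_mul_inv]

theorem one_sub_mul_sum_range_sub_mul_pow (x : ℝ) (n : ℕ) :
    (1 - x) * ∑ p ∈ Finset.range (n + 1), ((n : ℝ) + 1 - p) * x ^ p
      = (n : ℝ) + 1 - x * ∑ p ∈ Finset.range (n + 1), x ^ p := by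
  induction n with
  | zero => simp
  | succ n ih =>
    have h : ∑ p ∈ Finset.range (n + 1 + 1), (((n + 1 : ℕ) : ℝ) + 1 - p) * x ^ p
        = ∑ p ∈ Finset.range (n + 1), ((n : ℝ) + 1 - p) * x ^ p
          + ∑ p ∈ Finset.range (n + 1 + 1), x ^ p := by
      rw [Finset.sum_range_succ, Finset.sum_range_succ _ (n + 1), ← add_assoc,
        ← Finset.sum_add_distrib]
      congr 1
      · refine Finset.sum_congr rfl fun p _ => ?_
        push_cast
        ring
      · push_cast
        ring
    have hg := mul_neg_geom_sum x (n + 1 + 1)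
    rw [h, mul_add, ih, hg, Finset.sum_range_succ _ (n + 1)]
    push_cast
    ring

/-- Summation by parts: `q (H_n - H_{q-1}) - (q+1) (H_n - H_q) = 1 - (H_n - H_q)`. -/
theorem one_sub_mul_rPoly (x : ℝ) (n : ℕ) :
    (1 - x) * rPoly x n = ∑ p ∈ Finset.range n, x ^ p - x * zPoly x n := by
  induction n with
  | zero => simp [zPoly, rPoly]
  | succ n ih =>
    have hn : (n : ℝ) + 1 ≠ 0 := by positivity
    have hw := one_sub_mul_sum_range_sub_mul_pow x n
    have hs : ∑ p ∈ Finset.range (n + 1), x ^ p = x * ∑ p ∈ Finset.range n, x ^ p + 1 := by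
      rw [Finset.sum_range_succ', Finset.mul_sum]
      simp [pow_succ']
    rw [rPoly_succ, zPoly_succ, ← Finset.sum_div]
    field_simp
    field_simp at ih
    linear_combination hw + ((n : ℝ) + 1) * x * ih - ((n : ℝ) + 1) * hs

/-! ### The inner sums `c n p` -/

/-- The summand of `c (n + 1) p` with `k = n + 1 - p` is a coefficient of `cPoly`, divided by
`n + 1`. For `p = n` the sum `c n p` is empty. -/
theorem c_succ {n p : ℕ} (hp : p ≤ n) :
    c (n + 1) p = c n p
      + (H (n + 1) - H (n + 1 - 1 - p)) / ((n + 1 : ℕ) - (p : ℝ)) / ((n : ℝ) + 1) := by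
  obtain ⟨q, rfl⟩ := Nat.exists_eq_add_of_le hp
  have hq : (q : ℝ) + 1 ≠ 0 := by positivity
  have hpq : (p : ℝ) + q + 1 ≠ 0 := by positivity
  unfold c
  rw [show p + q + 1 - p = q + 1 by omega, show p + q - p = q by omega,
    show p + q + 1 - 1 - p = q by omega, Finset.sum_Icc_succ_top (by omega)]
  congr 1
  rw [show p + (q + 1) = p + q + 1 by omega, H_succ q]
  push_cast
  rw [show (p : ℝ) + q + 1 - p = q + 1 by ring, show (p : ℝ) + (q + 1) = p + q + 1 by ring]
  field_simp
  ring

theorem c_self (n : ℕ) : c n n = 0 := by simp [c]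

theorem sum_c_succ (n : ℕ) (g : ℕ → ℝ) :
    ∑ p ∈ Finset.range (n + 1), c (n + 1) p * g p = ∑ p ∈ Finset.range n, c n p * g p
      + (∑ p ∈ Finset.range (n + 1), (H (n + 1) - H (n + 1 - 1 - p)) / ((n + 1 : ℕ) - (p : ℝ))
          * g p) / ((n : ℝ) + 1) := by
  have h : ∑ p ∈ Finset.range n, c n p * g p = ∑ p ∈ Finset.range (n + 1), c n p * g p := by
    simp [Finset.sum_range_succ, c_self]
  rw [h, Finset.sum_div, ← Finset.sum_add_distrib]
  refine Finset.sum_congr rfl fun p hp => ?_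
  rw [c_succ (Nat.lt_succ_iff.mp (Finset.mem_range.mp hp))]
  ring

theorem sum_mul_cPoly_coeff (x : ℝ) (n : ℕ) :
    ∑ p ∈ Finset.range n, (H n - H (n - 1 - p)) / ((n : ℝ) - p) * ((p : ℝ) * x ^ p)
      = n * cPoly x n - zPoly x n := by
  unfold cPoly zPoly
  rw [Finset.mul_sum, ← Finset.sum_sub_distrib]
  refine Finset.sum_congr rfl fun p hp => ?_
  have : (n : ℝ) - p ≠ 0 := sub_ne_zero.mpr (by exact_mod_cast (Finset.mem_range.mp hp).ne')
  field_simp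
  ring

theorem sum_sq_mul_cPoly_coeff (x : ℝ) (n : ℕ) :
    ∑ p ∈ Finset.range n, (H n - H (n - 1 - p)) / ((n : ℝ) - p) * ((p : ℝ) ^ 2 * x ^ p)
      = n ^ 2 * cPoly x n - 2 * n * zPoly x n + rPoly x n := by
  unfold cPoly zPoly rPoly
  rw [Finset.mul_sum, Finset.mul_sum, ← Finset.sum_sub_distrib, ← Finset.sum_add_distrib]
  refine Finset.sum_congr rfl fun p hp => ?_
  have : (n : ℝ) - p ≠ 0 := sub_ne_zero.mpr (by exact_mod_cast (Finset.mem_range.mp hp).ne')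
  field_simp
  ring

/-! ### The closed form, sorted by powers of the logarithm -/

/-- The coefficient of `log (1-t) ^ 2 / 2` in `x ^ 2` times the closed form, where
`x = (t - 1) / t`, so that `t / (1-t)^2 = (1-x)/x^2` and `1 / (1-t)^2 = (1-x)^2/x^2`. -/
theorem sq_log_coeff_closedForm (x : ℝ) (n : ℕ) :
    (1 - x) * ∑ k ∈ Finset.Icc 1 n, x ^ k - (1 - x) ^ 2 * ∑ k ∈ Finset.Icc 1 n, (k : ℝ) * x ^ k
      = n * (1 - x) * x ^ (n + 1) := by
  induction n with
  | zero => simp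
  | succ n ih =>
    rw [Finset.sum_Icc_succ_top (by omega), Finset.sum_Icc_succ_top (by omega)]
    push_cast
    linear_combination ih

/-- The coefficient of `log (1-t)` in `x ^ 2` times the closed form. -/
theorem log_coeff_closedForm (x : ℝ) (n : ℕ) :
    x + (1 - x) * ∑ k ∈ Finset.Icc 1 n, 1 / (k : ℝ) * x ^ k
      - 2 * (1 - x) * ∑ k ∈ Finset.Icc 1 n, x ^ k
      - (1 - x) * ∑ k ∈ Finset.Icc 1 n, H k * x ^ k
      + (1 - x) ^ 2 * ∑ k ∈ Finset.Icc 1 n, (k : ℝ) * H k * x ^ k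
      = x ^ (n + 1) - (1 - x) * n * H n * x ^ (n + 1) := by
  induction n with
  | zero => simp
  | succ n ih =>
    have hu : ((n : ℝ) + 1) * (1 / ((n : ℝ) + 1)) = 1 := mul_one_div_cancel (by positivity)
    iterate 4 rw [Finset.sum_Icc_succ_top (by omega)]
    rw [H_succ]
    push_cast
    linear_combination ih + (1 - x) * x ^ (n + 1) * hu

/-- The part of `x ^ 2` times the closed form free of logarithms. -/
theorem rational_part_closedForm (x : ℝ) (n : ℕ) :
    -∑ k ∈ Finset.Icc 1 (n + 1), 1 / (k : ℝ) * x ^ k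
      + 2 * (1 - x) * ∑ k ∈ Finset.Icc 1 (n + 1), H k * x ^ k
      - (1 - x) * ∑ k ∈ Finset.Icc 1 (n + 1), H k / (k : ℝ) * x ^ k
      + (1 - x) * ∑ p ∈ Finset.range (n + 1), c (n + 1) p * ((p : ℝ) * x ^ p)
      - (1 - x) ^ 2 * ∑ p ∈ Finset.range (n + 1), c (n + 1) p * ((p : ℝ) ^ 2 * x ^ p)
      = x ^ 2 * (((n : ℝ) + 1) * (cPoly x n - cPoly x (n + 1))) := by
  induction n with
  | zero =>
    simp [cPoly, H_succ, H_zero]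
    ring
  | succ n ih =>
    have hz := one_sub_mul_zPoly x (n + 1 + 1)
    have hr := one_sub_mul_rPoly x (n + 1 + 1)
    have hg := mul_neg_geom_sum x (n + 1 + 1)
    rw [sum_c_succ (n + 1), sum_c_succ (n + 1), sum_mul_cPoly_coeff, sum_sq_mul_cPoly_coeff]
    iterate 3 rw [Finset.sum_Icc_succ_top (by omega : 1 ≤ n + 1 + 1)]
    rw [cPoly_succ x (n + 1), cPoly_succ x n, aPoly_succ x (n + 1)]
    rw [aPoly_succ x (n + 1)] at hz
    rw [cPoly_succ x n] at ih
    generalize zPoly x (n + 1 + 1) = z at *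
    generalize rPoly x (n + 1 + 1) = r at *
    generalize H (n + 1 + 1) = h at *
    generalize aPoly x (n + 1) = a at *
    generalize cPoly x n = b at *
    generalize ∑ k ∈ Finset.range (n + 1 + 1), x ^ k = g at *
    generalize ∑ k ∈ Finset.Icc 1 (n + 1), 1 / (k : ℝ) * x ^ k = s₁ at *
    generalize ∑ k ∈ Finset.Icc 1 (n + 1), H k * x ^ k = s₂ at *
    generalize ∑ k ∈ Finset.Icc 1 (n + 1), H k / (k : ℝ) * x ^ k = s₃ at *
    generalize ∑ p ∈ Finset.range (n + 1), c (n + 1) p * ((p : ℝ) * x ^ p) = s₄ at *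
    generalize ∑ p ∈ Finset.range (n + 1), c (n + 1) p * ((p : ℝ) ^ 2 * x ^ p) = s₅ at *
    push_cast at hz ⊢
    have hn : (n : ℝ) + 1 ≠ 0 := by positivity
    have hn' : (n : ℝ) + 1 + 1 ≠ 0 := by positivity
    -- The last terms turn `zPoly` and `rPoly`, which enter through `p = n - (n - p)` and its
    -- square, into `aPoly` and powers of `x`.
    linear_combination (norm := (field_simp; ring))
      ih + (1 / ((n : ℝ) + 1 + 1)) * ((1 - x) * (2 * ((n : ℝ) + 1 + 1) - 1) * hz
        - (1 - x) * hr - hg)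

theorem closedForm_eq (n : ℕ) {t : ℝ} (h0 : 0 < t) (h1 : t < 1) :
    closedForm (n + 1) t = ((n : ℝ) + 1) * (vSum t n - vSum t (n + 1)) := by
  have ht : t ≠ 0 := h0.ne'
  have ht' : 1 - t ≠ 0 := (sub_pos.mpr h1).ne'
  have hx : (t - 1) / t ≠ 0 := div_ne_zero (by intro h; exact ht' (by linarith)) ht
  have e0 := sq_log_coeff_closedForm ((t - 1) / t) (n + 1)
  have e1 := log_coeff_closedForm ((t - 1) / t) (n + 1)
  have e2 := rational_part_closedForm ((t - 1) / t) n
  unfold closedForm vSum f₀ f₁ f₂ f₃ f₄ f₅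
  simp only [mul_assoc (c _ _)]
  have hH := H_succ n
  generalize Real.log (1 - t) = L at *
  generalize ∑ k ∈ Finset.Icc 1 (n + 1), 1 / (k : ℝ) * ((t - 1) / t) ^ k = s₁ at *
  generalize ∑ k ∈ Finset.Icc 1 (n + 1), ((t - 1) / t) ^ k = s₂ at *
  generalize ∑ k ∈ Finset.Icc 1 (n + 1), H k * ((t - 1) / t) ^ k = s₃ at *
  generalize ∑ k ∈ Finset.Icc 1 (n + 1), H k / (k : ℝ) * ((t - 1) / t) ^ k = s₄ at *
  generalize ∑ k ∈ Finset.Icc 1 (n + 1), (k : ℝ) * H k * ((t - 1) / t) ^ k = s₅ at *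
  generalize ∑ k ∈ Finset.Icc 1 (n + 1), (k : ℝ) * ((t - 1) / t) ^ k = s₆ at *
  generalize ∑ p ∈ Finset.range (n + 1), c (n + 1) p * ((p : ℝ) * ((t - 1) / t) ^ p) = s₇ at *
  generalize ∑ p ∈ Finset.range (n + 1), c (n + 1) p * ((p : ℝ) ^ 2 * ((t - 1) / t) ^ p) = s₈
    at *
  generalize cPoly ((t - 1) / t) n = c₀ at *
  generalize cPoly ((t - 1) / t) (n + 1) = c₁ at *
  rw [hH] at e1 ⊢
  simp only [pow_succ ((t - 1) / t) (n + 1), pow_succ ((t - 1) / t) n] at *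
  generalize ((t - 1) / t) ^ n = y at *
  generalize H n = h at *
  push_cast at *
  have hn : (n : ℝ) + 1 ≠ 0 := by positivity
  -- `1 / x ^ 2 = t ^ 2 / (1 - t) ^ 2`.
  linear_combination (norm := (field_simp; ring))
    (t ^ 2 / (1 - t) ^ 2) * (e0 * (L ^ 2 / 2) + e1 * L + e2)

/-! ### The weights `n! j! / (n+j+1)!` -/

/-- The Beta value `B(n+1, j+1) = n! j! / (n+j+1)!`, which is `1 / (k * (n+k).choose k)` for
`k = j + 1`. -/
def beta (n j : ℕ) : ℝ := (n.factorial * j.factorial : ℝ) / (n + j + 1).factorial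

theorem beta_zero_left (j : ℕ) : beta 0 j = 1 / ((j : ℝ) + 1) := by
  have : (j.factorial : ℝ) ≠ 0 := by positivity
  simp [beta, Nat.factorial_succ]
  field_simp

theorem beta_zero_right (n : ℕ) : beta n 0 = 1 / ((n : ℝ) + 1) := by
  have : (n.factorial : ℝ) ≠ 0 := by positivity
  simp [beta, Nat.factorial_succ]
  field_simp

theorem beta_sub_beta_succ (n j : ℕ) : beta n j - beta n (j + 1) = beta (n + 1) j := by
  unfold beta
  rw [show n + (j + 1) + 1 = n + j + 1 + 1 by ring, show n + 1 + j + 1 = n + j + 1 + 1 by ring,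
    Nat.factorial_succ (n + j + 1), Nat.factorial_succ n, Nat.factorial_succ j]
  have h := Nat.factorial_ne_zero (n + j + 1)
  have : (n : ℝ) + j + 1 + 1 ≠ 0 := by positivity
  push_cast
  field_simp
  ring

theorem beta_succ_right (n j : ℕ) :
    beta n (j + 1) / ((j : ℝ) + 1) = beta (n + 1) j / ((n : ℝ) + 1) := by
  unfold beta
  rw [show n + (j + 1) + 1 = n + j + 1 + 1 by ring, show n + 1 + j + 1 = n + j + 1 + 1 by ring,
    Nat.factorial_succ n, Nat.factorial_succ j]
  push_cast
  field_simp

theorem inv_choose_eq (n j : ℕ) :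
    1 / ((n + 1 + (j + 1)).choose (j + 1) : ℝ) = ((n : ℝ) + 1) * (beta n j - beta (n + 1) j) := by
  rw [← beta_sub_beta_succ n j, sub_sub_cancel, Nat.cast_choose ℝ (Nat.le_add_left _ _),
    Nat.add_sub_cancel]
  unfold beta
  rw [show n + (j + 1) + 1 = n + 1 + (j + 1) by ring, Nat.factorial_succ n]
  push_cast
  field_simp

/-! ### Summing the series for `0 < t < 1` -/

/-- By `beta_sub_beta_succ`, passing from `n` to `n + 1` subtracts from the series its own shift,
which gives the recurrence of `aPoly_succ`; the case `n = 0` is the series of the logarithm. -/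
theorem hasSum_beta {t : ℝ} (h0 : 0 < t) (h1 : t < 1) (n : ℕ) :
    HasSum (fun j : ℕ => t ^ (j + 1) * beta n j)
      (aPoly ((t - 1) / t) n - ((t - 1) / t) ^ n * Real.log (1 - t)) := by
  induction n with
  | zero =>
    have h := Real.hasSum_pow_div_log_of_abs_lt_one (abs_lt.mpr ⟨by linarith, h1⟩ : |t| < 1)
    simpa [aPoly, beta_zero_left, div_eq_mul_inv] using h
  | succ n ih =>
    have hs := (hasSum_nat_add_iff' 1).mpr ih
    convert! ih.sub (hs.mul_left (1 / t)) using 1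
    · funext j
      rw [← beta_sub_beta_succ n j]
      field_simp
      ring
    · rw [aPoly_succ]
      simp only [Finset.sum_range_one, beta_zero_right, pow_succ]
      field_simp
      ring

theorem sum_range_one_div_mul (n : ℕ) :
    ∑ i ∈ Finset.range (n + 1), 1 / ((i : ℝ) + 1) * (1 / (((n - i : ℕ) : ℝ) + 1))
      = 2 * H (n + 1) / ((n : ℝ) + 2) := by
  have hH : H (n + 1) = ∑ i ∈ Finset.range (n + 1), 1 / ((i : ℝ) + 1) := by
    simp [H, harmonic]
  have hH' : H (n + 1) = ∑ i ∈ Finset.range (n + 1), 1 / (((n - i : ℕ) : ℝ) + 1) := by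
    rw [hH, ← Finset.sum_range_reflect]
    simp
  have h2 : 2 * H (n + 1) = ∑ i ∈ Finset.range (n + 1),
      (1 / ((i : ℝ) + 1) + 1 / (((n - i : ℕ) : ℝ) + 1)) := by
    rw [Finset.sum_add_distrib, ← hH, ← hH', two_mul]
  rw [h2, Finset.sum_div]
  refine Finset.sum_congr rfl fun i hi => ?_
  have hle : i ≤ n := Nat.lt_succ_iff.mp (Finset.mem_range.mp hi)
  have hc : (n : ℝ) = i + (n - i : ℕ) := by rw [← Nat.cast_add, Nat.add_sub_cancel' hle]
  rw [hc]
  generalize n - i = m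
  have : (i : ℝ) + m + 2 ≠ 0 := by positivity
  field_simp
  ring

/-- The Cauchy square of the series of `-log (1 - t)`. -/
theorem hasSum_log_sq {t : ℝ} (h0 : 0 < t) (h1 : t < 1) :
    HasSum (fun j : ℕ => H j * (t ^ (j + 1) * beta 0 j)) (Real.log (1 - t) ^ 2 / 2) := by
  have h := Real.hasSum_pow_div_log_of_abs_lt_one (abs_lt.mpr ⟨by linarith, h1⟩ : |t| < 1)
  have hm := hasSum_sum_range_mul_of_summable_norm h.summable.norm h.summable.norm
  rw [h.tsum_eq] at hm
  -- The term `j = 0` vanishes, since `H 0 = 0`.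
  rw [← hasSum_nat_add_iff' 1]
  convert! hm.div_const 2 using 1
  · funext n
    have hs : ∑ i ∈ Finset.range (n + 1),
        t ^ (i + 1) / ((i : ℝ) + 1) * (t ^ (n - i + 1) / (((n - i : ℕ) : ℝ) + 1))
        = t ^ (n + 2) * (2 * H (n + 1) / ((n : ℝ) + 2)) := by
      rw [← sum_range_one_div_mul, Finset.mul_sum]
      refine Finset.sum_congr rfl fun i hi => ?_
      have hle : i ≤ n := Nat.lt_succ_iff.mp (Finset.mem_range.mp hi)
      rw [show n + 2 = (i + 1) + (n - i + 1) by omega, pow_add]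
      ring
    rw [hs, beta_zero_left]
    push_cast
    rw [add_assoc (n : ℝ) 1 1, one_add_one_eq_two]
    ring
  · simp [H_zero]
    ring

/-- The recurrence is that of `hasSum_beta` up to the defect `H (j + 1) - H j = 1 / (j + 1)` of the
shift, which by `beta_succ_right` contributes `1 / (n + 1)` times the series of `hasSum_beta`
for `n + 1`. -/
theorem hasSum_H_mul_beta {t : ℝ} (h0 : 0 < t) (h1 : t < 1) (n : ℕ) :
    HasSum (fun j : ℕ => H j * (t ^ (j + 1) * beta n j)) (vSum t n) := by
  induction n with
  | zero => simpa [vSum, cPoly, H_zero] using hasSum_log_sq h0 h1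
  | succ n ih =>
    have hs := (hasSum_nat_add_iff' 1).mpr ih
    convert! (ih.sub (hs.mul_left (1 / t))).add
      ((hasSum_beta h0 h1 (n + 1)).mul_left (1 / ((n : ℝ) + 1))) using 1
    · funext j
      have hb := beta_sub_beta_succ n j
      have hb' := beta_succ_right n j
      rw [H_succ]
      have e : t ^ (j + 1 + 1) = t * t ^ (j + 1) := pow_succ' t _
      have ht : (1 / t) * t = 1 := one_div_mul_cancel h0.ne'
      rw [e]
      linear_combination (-H j * t ^ (j + 1)) * hb + t ^ (j + 1) * hb'
        + (H j + 1 / ((j : ℝ) + 1)) * t ^ (j + 1) * beta n (j + 1) * ht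
    · unfold vSum
      rw [cPoly_succ, H_succ]
      simp only [Finset.sum_range_one, H_zero, pow_succ]
      field_simp
      ring

theorem term_succ (n j : ℕ) (t : ℝ) :
    term (n + 1) t (j + 1)
      = ((n : ℝ) + 1) * (H j * (t ^ (j + 1) * beta n j) - H j * (t ^ (j + 1) * beta (n + 1) j)) := by
  have h := inv_choose_eq n j
  unfold term
  rw [Nat.add_sub_cancel, div_eq_mul_one_div, h]
  ring

theorem hasSum_term {t : ℝ} (h0 : 0 < t) (h1 : t < 1) (n : ℕ) :
    HasSum (fun j : ℕ => term (n + 1) t (j + 1)) (closedForm (n + 1) t) := by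
  rw [closedForm_eq n h0 h1]
  simp only [term_succ]
  exact ((hasSum_H_mul_beta h0 h1 n).sub (hasSum_H_mul_beta h0 h1 (n + 1))).mul_left _

/-! ### The endpoint `t = 1` -/

theorem H_nonneg (n : ℕ) : 0 ≤ H n := by
  simp only [H, harmonic]
  positivity

theorem H_le_two_mul_sqrt (n : ℕ) : H n ≤ 2 * √n := by
  induction n with
  | zero => simp [H_zero]
  | succ n ih =>
    rw [H_succ]
    push_cast
    have ha := Real.sq_sqrt (by positivity : (0 : ℝ) ≤ n)
    have hb := Real.sq_sqrt (by positivity : (0 : ℝ) ≤ (n : ℝ) + 1)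
    have hle : √(n : ℝ) ≤ √((n : ℝ) + 1) := Real.sqrt_le_sqrt (by linarith)
    have hpos : 1 ≤ √((n : ℝ) + 1) := Real.one_le_sqrt.mpr (by linarith [n.cast_nonneg (α := ℝ)])
    have h : 1 / ((n : ℝ) + 1) ≤ 2 * (√((n : ℝ) + 1) - √n) := by
      have : 1 / ((n : ℝ) + 1) ≤ 1 / √((n : ℝ) + 1) := by
        apply one_div_le_one_div_of_le (by linarith)
        nlinarith
      refine this.trans ?_
      rw [div_le_iff₀ (by linarith)]
      nlinarith [Real.sqrt_nonneg (n : ℝ)]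
    linarith

theorem choose_two_le_choose (n j : ℕ) :
    (j + 3).choose 2 ≤ (n + 2 + (j + 1)).choose (j + 1) := by
  calc (j + 3).choose 2 = (j + 3).choose (j + 1) := (Nat.choose_symm_add (a := j + 1) (b := 2)).symm
    _ ≤ _ := Nat.choose_le_choose _ (by omega)

/-- The terms are `O(j ^ (-3/2))`, as `H j = O(√j)` and the binomial coefficient is at least
`(j + 3).choose 2`. -/
theorem summable_term_one (n : ℕ) : Summable fun j : ℕ => term (n + 2) 1 (j + 1) := by
  have hs : Summable fun j : ℕ => 4 * (((j + 1 : ℕ) : ℝ) ^ (3 / 2 : ℝ))⁻¹ :=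
    ((summable_nat_add_iff 1).mpr (Real.summable_nat_rpow_inv.mpr (by norm_num))).mul_left 4
  refine hs.of_nonneg_of_le (fun j => ?_) fun j => ?_
  · have := H_nonneg j
    simp only [term, Nat.add_sub_cancel]
    positivity
  · have hc : ((j : ℝ) + 1) ^ 2 / 2 ≤ ((n + 2 + (j + 1)).choose (j + 1) : ℝ) := by
      have h2 : ((j + 3).choose 2 : ℝ) ≤ ((n + 2 + (j + 1)).choose (j + 1) : ℝ) := by
        exact_mod_cast choose_two_le_choose n j
      rw [Nat.cast_choose_two] at h2
      push_cast at h2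
      nlinarith [j.cast_nonneg (α := ℝ)]
    have hH : H j ≤ 2 * √((j : ℝ) + 1) :=
      (H_le_two_mul_sqrt j).trans (by gcongr; linarith)
    have hr : ((j : ℝ) + 1) ^ 2 = ((j : ℝ) + 1) ^ (3 / 2 : ℝ) * √((j : ℝ) + 1) := by
      rw [Real.sqrt_eq_rpow, ← Real.rpow_add (by positivity), ← Real.rpow_natCast]
      norm_num
    simp only [term, Nat.add_sub_cancel, one_pow, mul_one]
    calc H j / _ ≤ 2 * √((j : ℝ) + 1) / (((j : ℝ) + 1) ^ 2 / 2) := by gcongr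
      _ = _ := by
        rw [hr]
        push_cast
        have : √((j : ℝ) + 1) ≠ 0 := (Real.sqrt_pos.mpr (by positivity)).ne'
        field_simp
        norm_num

/-- Abel's limit theorem, applied to the series divided by `t`. -/
theorem tendsto_closedForm (n : ℕ) :
    Filter.Tendsto (closedForm (n + 2)) (𝓝[<] (1 : ℝ)) (𝓝 (∑' j : ℕ, term (n + 2) 1 (j + 1))) := by
  have habel := Real.tendsto_tsum_powerSeries_nhdsWithin_lt
    (summable_term_one n).hasSum.tendsto_sum_nat
  have hid : Filter.Tendsto (fun t : ℝ => t) (𝓝[<] (1 : ℝ)) (𝓝 1) :=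
    Filter.tendsto_id.mono_left nhdsWithin_le_nhds
  have h := hid.mul habel
  rw [one_mul] at h
  refine h.congr' ?_
  filter_upwards [Ioo_mem_nhdsLT (zero_lt_one (α := ℝ))] with t ht
  rw [← (hasSum_term ht.1 ht.2 (n + 1)).tsum_eq, ← tsum_mul_left]
  refine tsum_congr fun j => ?_
  simp only [term]
  ring

end HarmBinom

end

theorem theorem2p13 (n : ℕ) (hn : 1 ≤ n) :
    (∀ t : ℝ, 0 < t → t < 1 →
      HasSum (fun j : ℕ => HarmBinom.term n t (j + 1)) (HarmBinom.closedForm n t)) ∧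
    (2 ≤ n → ∃ S : ℝ,
      HasSum (fun j : ℕ => HarmBinom.term n 1 (j + 1)) S ∧
      Filter.Tendsto (HarmBinom.closedForm n) (𝓝[<] (1 : ℝ)) (𝓝 S)) := by
  refine ⟨fun t h0 h1 => ?_, fun h2 => ?_⟩
  · obtain ⟨m, rfl⟩ := Nat.exists_eq_add_of_le' hn
    exact HarmBinom.hasSum_term h0 h1 m
  · obtain ⟨m, rfl⟩ := Nat.exists_eq_add_of_le' h2
    exact ⟨_, (HarmBinom.summable_term_one m).hasSum, HarmBinom.tendsto_closedForm m⟩
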